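/- Let $(M,g)$ be a smooth Riemannian manifold with Levi-Civita connection $\nabla$ and curvature tensor $R(x,y)z=\nabla_x\nabla_yz-\nabla_y\nabla_xz-\nabla_{[x,y]}z$, and let $D_1,D_2$ be smooth complementary $g$-orthogonal distributions on $M$ of dimensions $p_1,p_2>0$. At a point of $M$ let $e_1,\dots,e_{p_1}$ be a $g$-orthonormal basis of $D_1$ and $\varepsilon_1,\dots,\varepsilon_{p_2}$ a $g$-orthonormal basis of $D_2$. The partial Ricci curvatures and the mixed scalar curvature are $$\operatorname{Ric}_1(x,y)=\sum_{\alpha=1}^{p_2}g(R(\varepsilon_\alpha,x)y,\varepsilon_\alpha),\qquad \operatorname{Ric}_2(x,y)=\sum_{i=1}^{p_1}g(R(e_i,x)y,e_i),\qquad K=\sum_{i=1}^{p_1}\sum_{\alpha=1}^{p_2}g(R(e_i,\varepsilon_\alpha)\varepsilon_\alpha,e_i).$$ For a smooth function $\phi:M\to(0,\infty)$ let $\nabla\phi$ be its $g$-gradient, $h_\phi(x,y)=g(\nabla_x\nabla\phi,y)$ its Hessian, and $\Delta^{(1)}\phi=\sum_{i}h_\phi(e_i,e_i)$, $\Delta^{(2)}\phi=\sum_{\alpha}h_\phi(\varepsilon_\alpha,\varepsilon_\alpha)$.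 Let $\widetilde{\operatorname{Ric}}_1,\widetilde{\operatorname{Ric}}_2,\tilde K$ be the corresponding quantities of the conformal metric $\tilde g=g/\phi^2$ and the same distributions (computed with $\tilde g$-orthonormal bases of $D_1$, $D_2$ and the curvature tensor of $\tilde g$). Then at every point of $M$ $$\widetilde{\operatorname{Ric}}_1(x,y)=\operatorname{Ric}_1(x,y)+\frac{p_2\,\phi\,h_\phi(x,y)+\big(\phi\,\Delta^{(2)}\phi-p_2|\nabla\phi|^2\big)g(x,y)}{\phi^2}\qquad\text{for all }x,y\in D_1,$$ $$\widetilde{\operatorname{Ric}}_2(x,y)=\operatorname{Ric}_2(x,y)+\frac{p_1\,\phi\,h_\phi(x,y)+\big(\phi\,\Delta^{(1)}\phi-p_1|\nabla\phi|^2\big)g(x,y)}{\phi^2}\qquad\text{for all }x,y\in D_2,$$ $$\tilde K=\phi^2K+\phi\big(p_1\Delta^{(2)}\phi+p_2\Delta^{(1)}\phi\big)-p_1p_2|\nabla\phi|^2,$$ where $|\nabla\phi|^2=g(\nabla\phi,\nabla\phi)$. -/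

import Mathlib

open scoped Manifold ContDiff Topology
open Bundle

/-! ## Levi-Civita calculus of a metric given in coordinates

`E` is the coordinate space; a metric in coordinates is a map `G : E → (E →L[ℝ] E →L[ℝ] ℝ)`,
whose value `G y u v` is the product of the coordinate vectors `u`, `v` at the point `y`. -/

namespace CoordMetric

noncomputable section

variable {E : Type*} [NormedAddCommGroup E] [NormedSpace ℝ E]

/-- The Christoffel symbol `Γ_y(u, v)`, i.e. `∇_u v` for constant coordinate fields `u`, `v`. It is
given by the Koszul formula `2 g(Γ(u, v), w) = ∂_u g(v, w) + ∂_v g(u, w) - ∂_w g(u, v)`; applying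
`(G y).inverse` raises the index. -/
def christoffel (G : E → E →L[ℝ] E →L[ℝ] ℝ) (y u v : E) : E :=
  (G y).inverse ((1 / 2 : ℝ) • (fderiv ℝ G y u v + fderiv ℝ G y v u
    - ((fderiv ℝ G y).flip u).flip v))

/-- The Levi-Civita connection: `(∇_u X)(y)` for a vector field `X : E → E` and a vector `u`. -/
def cov (G : E → E →L[ℝ] E →L[ℝ] ℝ) (X : E → E) (y u : E) : E :=
  fderiv ℝ X y u + christoffel G y u (X y)

/-- The curvature tensor `R(u, v) w = ∇_u ∇_v w - ∇_v ∇_u w - ∇_[u, v] w` at `y`, computed on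
constant coordinate fields `u`, `v`, `w`, for which `[u, v] = 0`. -/
def curvature (G : E → E →L[ℝ] E →L[ℝ] ℝ) (y u v w : E) : E :=
  cov G (fun z => cov G (fun _ => w) z v) y u - cov G (fun z => cov G (fun _ => w) z u) y v

/-- The gradient of a function: `G y (∇ f (y)) w = df_y(w)` for all `w`. -/
def grad (G : E → E →L[ℝ] E →L[ℝ] ℝ) (f : E → ℝ) (y : E) : E :=
  (G y).inverse (fderiv ℝ f y)

end

end CoordMetric

/-! ## Riemannian manifolds with distributions

`M` is a smooth manifold without boundary modelled on the finite-dimensional space `E`, and a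
Riemannian metric is Mathlib's `ContMDiffRiemannianMetric` on the tangent bundle. -/

noncomputable section

namespace PartialRicci

section

variable {E : Type*} [NormedAddCommGroup E] [NormedSpace ℝ E]
  {M : Type*} [TopologicalSpace M] [ChartedSpace E M] [IsManifold 𝓘(ℝ, E) ∞ M]

/-- Smooth Riemannian metrics on `M`. -/
abbrev SmoothMetric (E : Type*) [NormedAddCommGroup E] [NormedSpace ℝ E]
    (M : Type*) [TopologicalSpace M] [ChartedSpace E M] [IsManifold 𝓘(ℝ, E) ∞ M] :=
  ContMDiffRiemannianMetric 𝓘(ℝ, E) ∞ E (fun p : M => TangentSpace 𝓘(ℝ, E) p)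

/-- The differential of the inverse of the chart around `p`, at the coordinate point `y`: it sends
coordinate vectors to tangent vectors at the point with coordinates `y`. -/
def ofCoord (p : M) (y : E) :
    E →L[ℝ] TangentSpace 𝓘(ℝ, E) ((extChartAt 𝓘(ℝ, E) p).symm y) :=
  mfderiv 𝓘(ℝ, E) 𝓘(ℝ, E) (extChartAt 𝓘(ℝ, E) p).symm y

/-- The differential at `p` of the chart around `p`. -/
def toCoord (p : M) : TangentSpace 𝓘(ℝ, E) p →L[ℝ] E :=
  mfderiv 𝓘(ℝ, E) 𝓘(ℝ, E) (extChartAt 𝓘(ℝ, E) p) p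

/-- The coordinates of `p` in the chart around `p`. -/
def coordPt (E : Type*) [NormedAddCommGroup E] [NormedSpace ℝ E]
    {M : Type*} [TopologicalSpace M] [ChartedSpace E M] (p : M) : E :=
  extChartAt 𝓘(ℝ, E) p p

/-- The metric `g` in the chart around `p`: `G_y(u, v) = g(∂_u, ∂_v)`. -/
def metricInChart (g : SmoothMetric E M) (p : M) (y : E) : E →L[ℝ] E →L[ℝ] ℝ :=
  (ContinuousLinearMap.precomp ℝ (ofCoord p y)).comp
    ((g.inner ((extChartAt 𝓘(ℝ, E) p).symm y)).comp (ofCoord p y))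

theorem metricInChart_apply (g : SmoothMetric E M) (p : M) (y u v : E) :
    metricInChart g p y u v =
      g.inner ((extChartAt 𝓘(ℝ, E) p).symm y) (ofCoord p y u) (ofCoord p y v) := rfl

/-- A function in the chart around `p`. -/
def funInChart (f : M → ℝ) (p : M) (y : E) : ℝ := f ((extChartAt 𝓘(ℝ, E) p).symm y)

/-- `g_p(R(x, y) z, w)`, where `R` is the Riemannian curvature tensor of `g`. It is computed in the
chart around `p`. -/
def curv (g : SmoothMetric E M) (p : M) (x y z w : TangentSpace 𝓘(ℝ, E) p) : ℝ :=
  metricInChart g p (coordPt E p)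
    (CoordMetric.curvature (metricInChart g p) (coordPt E p)
      (toCoord p x) (toCoord p y) (toCoord p z)) (toCoord p w)

/-- The Hessian `h_f(x, y) = g(∇_x ∇ f, y)` at `p`. -/
def hess (g : SmoothMetric E M) (f : M → ℝ) (p : M) (x y : TangentSpace 𝓘(ℝ, E) p) : ℝ :=
  metricInChart g p (coordPt E p)
    (CoordMetric.cov (metricInChart g p) (CoordMetric.grad (metricInChart g p) (funInChart f p))
      (coordPt E p) (toCoord p x)) (toCoord p y)

/-- The squared length `|∇ f|² = g(∇ f, ∇ f)` of the gradient at `p`. -/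
def gradNormSq (g : SmoothMetric E M) (f : M → ℝ) (p : M) : ℝ :=
  metricInChart g p (coordPt E p)
    (CoordMetric.grad (metricInChart g p) (funInChart f p) (coordPt E p))
    (CoordMetric.grad (metricInChart g p) (funInChart f p) (coordPt E p))

/-- A smooth distribution of rank `k`: a field of tangent subspaces which around each point is
the span of `k` smooth, pointwise linearly independent vector fields. -/
structure SmoothDistribution (E : Type*) [NormedAddCommGroup E] [NormedSpace ℝ E]
    (M : Type*) [TopologicalSpace M] [ChartedSpace E M] [IsManifold 𝓘(ℝ, E) ∞ M] (k : ℕ) where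
  /-- the subspace at a point -/
  space (p : M) : Submodule ℝ (TangentSpace 𝓘(ℝ, E) p)
  exists_localFrame (p : M) : ∃ U : Set M, IsOpen U ∧ p ∈ U ∧
    ∃ X : Fin k → (q : M) → TangentSpace 𝓘(ℝ, E) q,
      (∀ i, ContMDiffOn 𝓘(ℝ, E) (𝓘(ℝ, E).prod 𝓘(ℝ, E)) ∞
        (fun q => (⟨q, X i q⟩ : TangentBundle 𝓘(ℝ, E) M)) U) ∧
      ∀ q ∈ U, LinearIndependent ℝ (fun i => X i q) ∧
        Submodule.span ℝ (Set.range fun i => X i q) = space q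

/-- The vectors `e i` form a `g`-orthonormal basis of the subspace `D` of the tangent space. -/
def IsOrthonormalBasis (g : SmoothMetric E M) {p : M} (D : Submodule ℝ (TangentSpace 𝓘(ℝ, E) p))
    {k : ℕ} (e : Fin k → TangentSpace 𝓘(ℝ, E) p) : Prop :=
  (∀ i j, g.inner p (e i) (e j) = if i = j then 1 else 0) ∧
    Submodule.span ℝ (Set.range e) = D

/-- The partial Ricci form `(x, y) ↦ ∑ i, g(R(e i, x) y, e i)`, where `e` is an orthonormal basis
of one of the distributions: a basis of `D₂` gives `Ric₁`, a basis of `D₁` gives `Ric₂`. -/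
def partialRic (g : SmoothMetric E M) {p : M} {k : ℕ} (e : Fin k → TangentSpace 𝓘(ℝ, E) p)
    (x y : TangentSpace 𝓘(ℝ, E) p) : ℝ :=
  ∑ i, curv g p (e i) x y (e i)

/-- The mixed scalar curvature `K = ∑ i, ∑ α, g(R(e i, ε α) ε α, e i)`, where `e`, `ε` are
orthonormal bases of the two distributions. -/
def mixedScal (g : SmoothMetric E M) {p : M} {k l : ℕ} (e : Fin k → TangentSpace 𝓘(ℝ, E) p)
    (ε : Fin l → TangentSpace 𝓘(ℝ, E) p) : ℝ :=
  ∑ i, ∑ α, curv g p (e i) (ε α) (ε α) (e i)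

/-- The partial laplacian `∑ i, h_f(e i, e i)`, where `e` is an orthonormal basis of the
distribution. -/
def partialLaplacian (g : SmoothMetric E M) (f : M → ℝ) {p : M} {k : ℕ}
    (e : Fin k → TangentSpace 𝓘(ℝ, E) p) : ℝ :=
  ∑ i, hess g f p (e i) (e i)

/-- The conformal metric `g / φ ^ 2`. -/
def conformal (g : SmoothMetric E M) (φ : M → ℝ) (hφ : ContMDiff 𝓘(ℝ, E) 𝓘(ℝ, ℝ) ∞ φ)
    (hpos : ∀ p, 0 < φ p) : SmoothMetric E M where
  inner p := (1 / φ p ^ 2) • g.inner p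
  symm p v w := by simp [g.symm p v w]
  pos p v hv := by
    have h1 := g.pos p v hv
    have h2 := hpos p
    simp only [smul_apply, smul_eq_mul]
    positivity
  isVonNBounded p := by
    have h2 := hpos p
    refine ((g.isVonNBounded p).image
      (φ p • ContinuousLinearMap.id ℝ (TangentSpace 𝓘(ℝ, E) p))).subset ?_
    intro v hv
    refine ⟨(φ p)⁻¹ • v, ?_, ?_⟩
    · simp only [Set.mem_ofPred_eq, smul_apply, smul_eq_mul, map_smul] at hv ⊢
      calc (φ p)⁻¹ * ((φ p)⁻¹ * g.inner p v v) = 1 / φ p ^ 2 * g.inner p v v := by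
            field_simp
        _ < 1 := hv
    · simp [smul_smul, h2.ne']
  contMDiff := by
    have h : ContMDiff 𝓘(ℝ, E) 𝓘(ℝ, ℝ) ∞ (fun p => 1 / φ p ^ 2) :=
      contMDiff_const.div₀ (hφ.pow 2) (fun p => (pow_pos (hpos p) 2).ne')
    exact h.smul_section g.contMDiff

end

end PartialRicci

end

/-! The formulas are traces of the conformal transformation law of the curvature tensor.
Differentiating f⁻²G in the Koszul formula gives the new Christoffel symbols
(`christoffel_conformal`). Differentiating once more, the curvature form of g/f² is f⁻² times that
of g, plus f⁻¹ times the Kulkarni–Nomizu type product of g with the Hessian, minus f⁻²|∇f|² times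
that of g with itself (`curvature_conformal`, carried to the manifold by `curv_conformal`).

Inserting x, y orthogonal to the distribution being traced kills the terms that pair x or y with a
basis vector. The surviving sums over a g/φ²-orthonormal basis equal φ² times those over a
g-orthonormal basis (`sum_bilin_eq_mul_sum_bilin`). This gives `partialRic_conformal`; a second
trace over the other distribution gives `mixedScal_conformal`. -/

section

set_option maxSynthPendingDepth 3

/-! ### Levi-Civita calculus in coordinates -/

namespace CoordMetric

variable {E : Type*} [NormedAddCommGroup E] [NormedSpace ℝ E]

/-- Near the point `y`, `G` is a nondegenerate symmetric bilinear form of class `C^2`. -/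
structure IsMetricAt (G : E → E →L[ℝ] E →L[ℝ] ℝ) (y : E) : Prop where
  contDiffAt : ContDiffAt ℝ 2 G y
  symm : ∀ᶠ z in 𝓝 y, ∀ u v, G z u v = G z v u
  isInvertible : (G y).IsInvertible

section Pointwise

variable {G : E → E →L[ℝ] E →L[ℝ] ℝ} {y : E}

theorem apply_christoffel (hG : (G y).IsInvertible) (u v w : E) :
    G y (christoffel G y u v) w =
      (fderiv ℝ G y u v w + fderiv ℝ G y v u w - fderiv ℝ G y w u v) / 2 := by
  rw [christoffel, hG.self_apply_inverse]
  simp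
  ring

theorem apply_grad (hG : (G y).IsInvertible) (f : E → ℝ) (w : E) :
    G y (grad G f y) w = fderiv ℝ f y w := by
  rw [grad, hG.self_apply_inverse]

/-- The Christoffel symbol as a bilinear map. -/
noncomputable def christoffelL (G : E → E →L[ℝ] E →L[ℝ] ℝ) (y : E) : E →L[ℝ] E →L[ℝ] E :=
  (ContinuousLinearMap.compL ℝ E (E →L[ℝ] ℝ) E (G y).inverse).comp
    ((1 / 2 : ℝ) • (fderiv ℝ G y + (fderiv ℝ G y).flip -
      ((ContinuousLinearMap.flipₗᵢ ℝ E E ℝ).toContinuousLinearEquiv.toContinuousLinearMap.comp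
        (fderiv ℝ G y).flip)))

theorem christoffelL_apply (G : E → E →L[ℝ] E →L[ℝ] ℝ) (y u v : E) :
    christoffelL G y u v = christoffel G y u v := by
  simp only [christoffelL, christoffel, ContinuousLinearMap.comp_apply,
    ContinuousLinearMap.compL_apply]
  congr 1

end Pointwise

namespace IsMetricAt

variable {G : E → E →L[ℝ] E →L[ℝ] ℝ} {y : E}

theorem eventually [CompleteSpace E] (hG : IsMetricAt G y) : ∀ᶠ z in 𝓝 y, IsMetricAt G z := by
  obtain ⟨e, he⟩ := hG.isInvertible
  -- Invertible operators form an open set, so nondegeneracy at one point spreads nearby.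
  have hinv : ∀ᶠ z in 𝓝 y, G z ∈ Set.range
      ((↑) : (E ≃L[ℝ] (E →L[ℝ] ℝ)) → E →L[ℝ] (E →L[ℝ] ℝ)) :=
    hG.contDiffAt.continuousAt.eventually_mem (he ▸ ContinuousLinearEquiv.nhds e)
  filter_upwards [hG.contDiffAt.eventually (by simp), hG.symm.eventually_nhds, hinv]
    with z h₁ h₂ h₃
  exact ⟨h₁, h₂, h₃⟩

theorem differentiableAt (hG : IsMetricAt G y) : DifferentiableAt ℝ G y :=
  hG.contDiffAt.differentiableAt (by simp)

theorem apply_comm (hG : IsMetricAt G y) (u v : E) : G y u v = G y v u :=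
  hG.symm.self_of_nhds u v

theorem fderiv_comm (hG : IsMetricAt G y) (u v w : E) :
    fderiv ℝ G y u v w = fderiv ℝ G y u w v := by
  have key (a b : E) : fderiv ℝ (fun z => G z a b) y u = fderiv ℝ G y u a b := by
    rw [((hG.differentiableAt.hasFDerivAt.clm_apply (hasFDerivAt_const a y)).clm_apply
      (hasFDerivAt_const b y)).fderiv]
    simp
  rw [← key, ← key]
  congr 1
  exact Filter.EventuallyEq.fderiv_eq (hG.symm.mono fun z hz => hz v w)

/-- Vanishing torsion: the Koszul formula is symmetric in u, v, and a nondegenerate metric detects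
equality. -/
theorem christoffel_comm (hG : IsMetricAt G y) (u v : E) :
    christoffel G y u v = christoffel G y v u := by
  apply hG.isInvertible.injective
  ext w
  rw [apply_christoffel hG.isInvertible, apply_christoffel hG.isInvertible,
    hG.fderiv_comm w u v]
  ring

/-- The Levi-Civita connection is compatible with the metric. -/
theorem fderiv_apply (hG : IsMetricAt G y) (u v w : E) :
    fderiv ℝ G y u v w = G y (christoffel G y u v) w + G y v (christoffel G y u w) := by
  rw [hG.apply_comm v, apply_christoffel hG.isInvertible, apply_christoffel hG.isInvertible,
    hG.fderiv_comm u w v, hG.fderiv_comm w u v, hG.fderiv_comm v u w]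
  ring

theorem contDiffAt_inverse [CompleteSpace E] (hG : IsMetricAt G y) :
    ContDiffAt ℝ 2 (fun z => (G z).inverse) y :=
  hG.isInvertible.contDiffAt_map_inverse.comp y hG.contDiffAt

theorem differentiableAt_fderiv (hG : IsMetricAt G y) : DifferentiableAt ℝ (fderiv ℝ G) y :=
  (hG.contDiffAt.fderiv_right (m := 1) (by norm_num)).differentiableAt (by simp)

theorem differentiableAt_christoffelL [CompleteSpace E] (hG : IsMetricAt G y) :
    DifferentiableAt ℝ (christoffelL G) y := by
  have h₁ := hG.differentiableAt_fderiv
  have h₂ : DifferentiableAt ℝ (fun z => (G z).inverse) y :=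
    hG.contDiffAt_inverse.differentiableAt (by simp)
  have h₃ : DifferentiableAt ℝ (fun z => (fderiv ℝ G z).flip) y :=
    (ContinuousLinearMap.flipₗᵢ ℝ E E (E →L[ℝ] ℝ)).differentiableAt.comp y h₁
  have h₄ := (ContinuousLinearMap.compL ℝ E (E →L[ℝ] ℝ) E).differentiableAt.comp y h₂
  exact h₄.clm_comp
    (((h₁.add h₃).sub ((differentiableAt_const _).clm_comp h₃)).const_smul (1 / 2 : ℝ))

theorem differentiableAt_christoffel [CompleteSpace E] (hG : IsMetricAt G y) (u v : E) :
    DifferentiableAt ℝ (fun z => christoffel G z u v) y := by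
  have := hG.differentiableAt_christoffelL
  simp only [← christoffelL_apply]
  fun_prop

/-- Makes linearity in v and w visible after differentiation; the multilinearity of curvature rests
on this. -/
theorem fderiv_christoffel [CompleteSpace E] (hG : IsMetricAt G y) (u v w : E) :
    fderiv ℝ (fun z => christoffel G z v w) y u = fderiv ℝ (christoffelL G) y u v w := by
  simp only [← christoffelL_apply]
  rw [((hG.differentiableAt_christoffelL.hasFDerivAt.clm_apply
    (hasFDerivAt_const v y)).clm_apply (hasFDerivAt_const w y)).fderiv]
  simp

end IsMetricAt

theorem curvature_eq (G : E → E →L[ℝ] E →L[ℝ] ℝ) (y u v w : E) :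
    curvature G y u v w =
      fderiv ℝ (fun z => christoffel G z v w) y u + christoffel G y u (christoffel G y v w) -
        (fderiv ℝ (fun z => christoffel G z u w) y v +
          christoffel G y v (christoffel G y u w)) := by
  simp [curvature, cov]

/-- The curvature tensor in terms of the Christoffel map and its derivative. -/
theorem IsMetricAt.curvature_eq_christoffelL [CompleteSpace E] {G : E → E →L[ℝ] E →L[ℝ] ℝ} {y : E}
    (hG : IsMetricAt G y) (u v w : E) :
    curvature G y u v w =
      fderiv ℝ (christoffelL G) y u v w + christoffelL G y u (christoffelL G y v w) -
        (fderiv ℝ (christoffelL G) y v u w + christoffelL G y v (christoffelL G y u w)) := by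
  simp only [curvature_eq, hG.fderiv_christoffel, christoffelL_apply]

section Gradient

variable [CompleteSpace E] {G : E → E →L[ℝ] E →L[ℝ] ℝ} {f : E → ℝ} {y : E}

theorem IsMetricAt.differentiableAt_grad (hG : IsMetricAt G y) (hf : ContDiffAt ℝ 2 f y) :
    DifferentiableAt ℝ (grad G f) y := by
  have h₁ : DifferentiableAt ℝ (fun z => (G z).inverse) y :=
    hG.contDiffAt_inverse.differentiableAt (by simp)
  have h₂ : DifferentiableAt ℝ (fderiv ℝ f) y :=
    (hf.fderiv_right (m := 1) (by norm_num)).differentiableAt (by simp)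
  exact DifferentiableAt.clm_apply (G := E →L[ℝ] ℝ) h₁ h₂

/-- Product rule applied to G(∇f, ·) = df, which holds on a neighbourhood. -/
theorem IsMetricAt.apply_fderiv_grad (hG : IsMetricAt G y) (hf : ContDiffAt ℝ 2 f y) (u w : E) :
    G y (fderiv ℝ (grad G f) y u) w =
      fderiv ℝ (fderiv ℝ f) y u w - fderiv ℝ G y u (grad G f y) w := by
  have h₂ : DifferentiableAt ℝ (fderiv ℝ f) y :=
    (hf.fderiv_right (m := 1) (by norm_num)).differentiableAt (by simp)
  have key : (fun z => G z (grad G f z)) =ᶠ[𝓝 y] fderiv ℝ f := by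
    filter_upwards [hG.eventually] with z hz
    ext w
    exact apply_grad hz.isInvertible f w
  have := key.fderiv_eq (𝕜 := ℝ)
  rw [(hG.differentiableAt.hasFDerivAt.clm_apply
    (hG.differentiableAt_grad hf).hasFDerivAt).fderiv] at this
  rw [← this]
  simp

/-- The Hessian is the second derivative corrected by the Christoffel symbol. -/
theorem IsMetricAt.apply_cov_grad (hG : IsMetricAt G y) (hf : ContDiffAt ℝ 2 f y) (u w : E) :
    G y (cov G (grad G f) y u) w =
      fderiv ℝ (fderiv ℝ f) y u w - fderiv ℝ f y (christoffel G y u w) := by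
  rw [cov, map_add, add_apply, hG.apply_fderiv_grad hf, hG.fderiv_apply,
    apply_grad hG.isInvertible]
  ring

end Gradient

/-! ### Conformal change in coordinates -/

section Conformal

variable {G G' : E → E →L[ℝ] E →L[ℝ] ℝ} {f : E → ℝ} {y : E}

theorem IsMetricAt.conformal (hG : IsMetricAt G y) (hf : ContDiffAt ℝ 2 f y) (hfy : f y ≠ 0)
    (hG' : ∀ᶠ z in 𝓝 y, G' z = (1 / f z ^ 2) • G z) : IsMetricAt G' y where
  contDiffAt := by
    refine ContDiffAt.congr_of_eventuallyEq ?_ hG'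
    exact (contDiffAt_const.div (hf.pow 2) (pow_ne_zero 2 hfy)).smul hG.contDiffAt
  symm := by
    filter_upwards [hG', hG.symm] with z h₁ h₂ u v
    simp [h₁, h₂ u v]
  isInvertible := by
    obtain ⟨e, he⟩ := hG.isInvertible
    rw [hG'.self_of_nhds, ← he]
    refine ContinuousLinearMap.IsInvertible.of_inverse
      (g := (f y ^ 2) • (e.symm : (E →L[ℝ] ℝ) →L[ℝ] E)) ?_ ?_ <;>
    · ext
      simp [hfy]

/-- Both sides are compared after pairing with an arbitrary w, where d(f⁻²) = -2f⁻³ df enters the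
Koszul formula. -/
theorem IsMetricAt.christoffel_conformal (hG : IsMetricAt G y) (hf : ContDiffAt ℝ 2 f y)
    (hfy : f y ≠ 0) (hG' : ∀ᶠ z in 𝓝 y, G' z = (1 / f z ^ 2) • G z) (u v : E) :
    christoffel G' y u v = christoffel G y u v - (f y)⁻¹ •
      (fderiv ℝ f y u • v + fderiv ℝ f y v • u - G y u v • grad G f y) := by
  have hi := (hG.conformal hf hfy hG').isInvertible
  have hd : HasFDerivAt f (fderiv ℝ f y) y := (hf.differentiableAt (by simp)).hasFDerivAt
  have hc : HasFDerivAt (fun z => 1 / f z ^ 2) ((-2 / f y ^ 3) • fderiv ℝ f y) y := by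
    have := (hasDerivAt_zpow (-2) (f y) (Or.inl hfy)).comp_hasFDerivAt y hd
    convert! this using 1
    · ext z; simp [zpow_neg]
    · congr 1
      simp [zpow_neg, div_eq_mul_inv]
  have hD (a b c : E) : fderiv ℝ G' y a b c =
      1 / f y ^ 2 * fderiv ℝ G y a b c + -2 / f y ^ 3 * fderiv ℝ f y a * G y b c := by
    have : HasFDerivAt (fun z => (1 / f z ^ 2) • G z) _ y :=
      hc.smul hG.differentiableAt.hasFDerivAt
    rw [Filter.EventuallyEq.fderiv_eq hG', this.fderiv]
    simp
  apply hi.injective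
  ext w
  rw [apply_christoffel hi, hD, hD, hD, hG'.self_of_nhds]
  simp only [smul_apply, map_sub, map_add, map_smul, sub_apply, add_apply, smul_eq_mul,
    apply_christoffel hG.isInvertible, apply_grad hG.isInvertible]
  field_simp
  ring

variable [CompleteSpace E]

theorem IsMetricAt.fderiv_christoffel_conformal (hG : IsMetricAt G y) (hf : ContDiffAt ℝ 2 f y)
    (hfy : f y ≠ 0) (hG' : ∀ᶠ z in 𝓝 y, G' z = (1 / f z ^ 2) • G z) (u v w : E) :
    fderiv ℝ (fun z => christoffel G' z v w) y u =
      fderiv ℝ (fun z => christoffel G z v w) y u +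
        ((f y ^ 2)⁻¹ * fderiv ℝ f y u) •
          (fderiv ℝ f y v • w + fderiv ℝ f y w • v - G y v w • grad G f y) -
        (f y)⁻¹ • (fderiv ℝ (fderiv ℝ f) y u v • w + fderiv ℝ (fderiv ℝ f) y u w • v -
          fderiv ℝ G y u v w • grad G f y - G y v w • fderiv ℝ (grad G f) y u) := by
  -- The pointwise law may be differentiated because its hypotheses persist near y.
  have key : (fun z => christoffel G' z v w) =ᶠ[𝓝 y] fun z => christoffel G z v w - (f z)⁻¹ •
      (fderiv ℝ f z v • w + fderiv ℝ f z w • v - G z v w • grad G f z) := by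
    filter_upwards [hG.eventually, hf.eventually (by simp), hf.continuousAt.eventually_ne hfy,
      hG'.eventually_nhds] with z h₁ h₂ h₃ h₄
    exact h₁.christoffel_conformal h₂ h₃ h₄ v w
  have hd : HasFDerivAt f (fderiv ℝ f y) y := (hf.differentiableAt (by simp)).hasFDerivAt
  have hdd : HasFDerivAt (fderiv ℝ f) (fderiv ℝ (fderiv ℝ f) y) y :=
    ((hf.fderiv_right (m := 1) (by norm_num)).differentiableAt (by simp)).hasFDerivAt
  have hdd' (a : E) := hdd.clm_apply (hasFDerivAt_const a y)
  have hGd := (hG.differentiableAt.hasFDerivAt.clm_apply (hasFDerivAt_const v y)).clm_apply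
    (hasFDerivAt_const w y)
  have hN := (hG.differentiableAt_grad hf).hasFDerivAt
  have hinv := (hasDerivAt_inv hfy).comp_hasFDerivAt y hd
  rw [key.fderiv_eq]
  refine (DFunLike.congr_fun ((hG.differentiableAt_christoffel v w).hasFDerivAt.sub
    (hinv.smul ((((hdd' v).smul_const w).add ((hdd' w).smul_const v)).sub
      (hGd.smul hN)))).fderiv u).trans ?_
  simp
  module

/-- The curvature form of the conformal metric `g / f ^ 2`, up to the factor `1 / f ^ 2`. -/
theorem IsMetricAt.curvature_conformal (hG : IsMetricAt G y) (hf : ContDiffAt ℝ 2 f y)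
    (hfy : f y ≠ 0) (hG' : ∀ᶠ z in 𝓝 y, G' z = (1 / f z ^ 2) • G z) (u v w t : E) :
    G y (curvature G' y u v w) t = G y (curvature G y u v w) t +
      (f y)⁻¹ * (G y v w * G y (cov G (grad G f) y u) t + G y (cov G (grad G f) y v) w * G y u t -
        G y u w * G y (cov G (grad G f) y v) t - G y (cov G (grad G f) y u) w * G y v t) -
      (f y ^ 2)⁻¹ * G y (grad G f y) (grad G f y) * (G y v w * G y u t - G y u w * G y v t) := by
  have hsymm : fderiv ℝ (fderiv ℝ f) y u v = fderiv ℝ (fderiv ℝ f) y v u :=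
    (hf.isSymmSndFDerivAt (by simp)) u v
  have hN := apply_grad hG.isInvertible f
  simp only [curvature_eq, hG.fderiv_christoffel_conformal hf hfy hG',
    hG.christoffel_conformal hf hfy hG', hG.apply_cov_grad hf]
  simp only [← christoffelL_apply]
  -- Metric compatibility eliminates derivatives of G, and df becomes G(∇f, ·); zero torsion and
  -- symmetry of G then bring all terms to a common form, so the identity is algebraic.
  simp only [map_add, map_sub, map_smul, add_apply, sub_apply, smul_apply, smul_eq_mul,
    hG.apply_fderiv_grad hf, hG.fderiv_apply, ← hN, hsymm, ← christoffelL_apply]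
  rw [show christoffelL G y v u = christoffelL G y u v by
    simp only [christoffelL_apply, hG.christoffel_comm]]
  simp only [hG.apply_comm _ (grad G f y), hG.apply_comm v u]
  field_simp
  ring

end Conformal

end CoordMetric

/-! ### Traces over rescaled orthonormal bases -/

/-- The trace of a bilinear form `B` with respect to a symmetric form `g` on a subspace can be
computed on any two orthogonal bases whose vectors have constant square length. -/
theorem sum_bilin_eq_mul_sum_bilin {V ι : Type*} [AddCommGroup V] [Module ℝ V] [Fintype ι]
    [DecidableEq ι] (g B : V →ₗ[ℝ] V →ₗ[ℝ] ℝ) {e e' : ι → V} {c : ℝ} (hc : c ≠ 0)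
    (he : ∀ i j, g (e i) (e j) = if i = j then 1 else 0)
    (he' : ∀ i j, g (e' i) (e' j) = if i = j then c else 0)
    (hspan : ∀ i, e' i ∈ Submodule.span ℝ (Set.range e)) :
    ∑ i, B (e' i) (e' i) = c * ∑ i, B (e i) (e i) := by
  choose A hA using fun i => (Submodule.mem_span_range_iff_exists_fun ℝ).1 (hspan i)
  have hB (C : V →ₗ[ℝ] V →ₗ[ℝ] ℝ) (i j : ι) :
      C (e' i) (e' j) = ∑ k, ∑ l, A i k * A j l * C (e k) (e l) := by
    simp only [← hA, map_sum, LinearMap.sum_apply, map_smul, LinearMap.smul_apply, smul_eq_mul,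
      Finset.mul_sum]
    rw [Finset.sum_comm]
    exact Finset.sum_congr rfl fun k _ => Finset.sum_congr rfl fun l _ => by ring
  -- The Gram relations say AAᵀ = c. Since A is square, AᵀA = c as well, and that is what the trace
  -- needs.
  have h₁ : (Matrix.of A) * (c⁻¹ • (Matrix.of A).transpose) = 1 := by
    ext i j
    have := he' i j
    rw [hB g] at this
    simp only [he, mul_ite, mul_one, mul_zero, Finset.sum_ite_eq, Finset.mem_univ, if_true] at this
    simp only [Matrix.mul_apply, Matrix.smul_apply, Matrix.transpose_apply, Matrix.of_apply,
      smul_eq_mul, Matrix.one_apply]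
    calc ∑ k, A i k * (c⁻¹ * A j k) = c⁻¹ * ∑ k, A i k * A j k := by
          rw [Finset.mul_sum]
          exact Finset.sum_congr rfl fun k _ => by ring
      _ = _ := by rw [this]; split_ifs <;> simp [hc]
  have h₂ (k l : ι) : ∑ i, A i k * A i l = if k = l then c else 0 := by
    have := congrArg (fun N : Matrix ι ι ℝ => N k l) (mul_eq_one_comm.1 h₁)
    simp only [Matrix.mul_apply, Matrix.smul_apply, Matrix.transpose_apply, Matrix.of_apply,
      smul_eq_mul, Matrix.one_apply, mul_assoc, ← Finset.mul_sum] at this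
    rw [inv_mul_eq_iff_eq_mul₀ hc] at this
    rw [this]
    split_ifs <;> simp
  calc ∑ i, B (e' i) (e' i) = ∑ k, ∑ l, (∑ i, A i k * A i l) * B (e k) (e l) := by
        simp only [hB B, Finset.sum_mul]
        rw [Finset.sum_comm]
        exact Finset.sum_congr rfl fun k _ => Finset.sum_comm
    _ = _ := by simp [h₂, Finset.mul_sum]

/-! ### Passage from charts to the manifold -/

namespace PartialRicci

variable {E : Type*} [NormedAddCommGroup E] [NormedSpace ℝ E]
  {M : Type*} [TopologicalSpace M] [ChartedSpace E M] [IsManifold 𝓘(ℝ, E) ∞ M]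

theorem toCoord_apply (p : M) (x : TangentSpace 𝓘(ℝ, E) p) : toCoord p x = x := by
  have : IsManifold 𝓘(ℝ, E) 1 M := IsManifold.of_le (n := ∞) (by simp)
  exact DFunLike.congr_fun (mfderiv_extChartAt_self (I := 𝓘(ℝ, E)) (x := p)) x

/-- The differential of the inverse chart is the inverse of the tangent bundle trivialization. The
base point x is a separate variable so that it can be p itself, which equals the image of its
coordinates only propositionally. -/
theorem metricInChart_eq (g : SmoothMetric E M) (p : M) {y : E}
    (hy : y ∈ (extChartAt 𝓘(ℝ, E) p).target) {x : M} (hx : x = (extChartAt 𝓘(ℝ, E) p).symm y)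
    (u v : E) :
    metricInChart g p y u v =
      g.inner x ((trivializationAt E (TangentSpace 𝓘(ℝ, E)) p).symm x u)
        ((trivializationAt E (TangentSpace 𝓘(ℝ, E)) p).symm x v) := by
  have : IsManifold 𝓘(ℝ, E) 1 M := IsManifold.of_le (n := ∞) (by simp)
  subst hx
  have hs : (extChartAt 𝓘(ℝ, E) p).symm y ∈ (chartAt E p).source := by
    rw [← extChartAt_source 𝓘(ℝ, E)]
    exact (extChartAt 𝓘(ℝ, E) p).map_target hy
  have key (w : E) : ofCoord p y w =
      (trivializationAt E (TangentSpace 𝓘(ℝ, E)) p).symm ((extChartAt 𝓘(ℝ, E) p).symm y) w := by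
    have := TangentBundle.symmL_trivializationAt (I := 𝓘(ℝ, E)) hs
    rw [(extChartAt 𝓘(ℝ, E) p).right_inv hy, modelWithCornersSelf_coe, Set.range_id,
      mfderivWithin_univ] at this
    exact (DFunLike.congr_fun this w).symm.trans (Trivialization.symmL_apply _ hs w)
  rw [metricInChart_apply, key, key]

theorem metricInChart_coordPt (g : SmoothMetric E M) (p : M) (u v : TangentSpace 𝓘(ℝ, E) p) :
    metricInChart g p (coordPt E p) u v = g.inner p u v := by
  have : IsManifold 𝓘(ℝ, E) 1 M := IsManifold.of_le (n := ∞) (by simp)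
  have key (w : E) :
      (trivializationAt E (TangentSpace 𝓘(ℝ, E)) p).symm p w = w := by
    have := TangentBundle.symmL_trivializationAt (I := 𝓘(ℝ, E)) (mem_chart_source E p)
    rw [mfderivWithin_range_extChartAt_symm] at this
    exact (Trivialization.symmL_apply (R := ℝ)
      (trivializationAt E (TangentSpace 𝓘(ℝ, E)) p) (mem_chart_source E p) w).symm.trans
      (DFunLike.congr_fun this w)
  refine (metricInChart_eq g p (mem_extChartAt_target p) (extChartAt_to_inv p).symm u v).trans ?_
  exact congrArg₂ (fun a b => g.inner p a b) (key u) (key v)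

/-- Smoothness of g as a section of a hom bundle is smoothness in trivializations, which
`metricInChart_eq` identifies with the chart expression. -/
theorem contDiffAt_metricInChart (g : SmoothMetric E M) (p : M) :
    ContDiffAt ℝ 2 (metricInChart g p) (coordPt E p) := by
  have hg := (contMDiffAt_hom_bundle _).1 (g.contMDiff.contMDiffAt (x := p)) |>.2
  have hs : ContMDiffAt 𝓘(ℝ, E) 𝓘(ℝ, E) ∞ (extChartAt 𝓘(ℝ, E) p).symm (coordPt E p) :=
    (contMDiffOn_extChartAt_symm p).contMDiffAt (extChartAt_target_mem_nhds p)
  have hp : (extChartAt 𝓘(ℝ, E) p).symm (coordPt E p) = p := extChartAt_to_inv p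
  have hc := (ContMDiffAt.comp_of_eq hg hs hp).contDiffAt.of_le (m := 2) (WithTop.coe_le_coe.2 le_top)
  refine hc.congr_of_eventuallyEq ?_
  filter_upwards [extChartAt_target_mem_nhds (I := 𝓘(ℝ, E)) p] with y hy
  have hx : (extChartAt 𝓘(ℝ, E) p).symm y ∈ (chartAt E p).source := by
    rw [← extChartAt_source 𝓘(ℝ, E)]
    exact (extChartAt 𝓘(ℝ, E) p).map_target hy
  ext u v
  rw [metricInChart_eq g p hy rfl]
  refine Eq.trans ?_ (inCoordinates_apply_eq₂ (E₃ := fun _ => ℝ) hx hx (Set.mem_univ _)).symm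
  simp

theorem contDiffAt_funInChart {φ : M → ℝ} (hφ : ContMDiff 𝓘(ℝ, E) 𝓘(ℝ, ℝ) ∞ φ) (p : M) :
    ContDiffAt ℝ 2 (funInChart (E := E) φ p) (coordPt E p) := by
  have hs : ContMDiffAt 𝓘(ℝ, E) 𝓘(ℝ, E) ∞ (extChartAt 𝓘(ℝ, E) p).symm (coordPt E p) :=
    (contMDiffOn_extChartAt_symm p).contMDiffAt (extChartAt_target_mem_nhds p)
  exact (hφ.contMDiffAt.comp _ hs).contDiffAt.of_le (WithTop.coe_le_coe.2 le_top)

omit [IsManifold 𝓘(ℝ, E) ∞ M] in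
theorem funInChart_coordPt (φ : M → ℝ) (p : M) : funInChart φ p (coordPt E p) = φ p :=
  congrArg φ (extChartAt_to_inv p)

theorem isMetricAt_metricInChart [FiniteDimensional ℝ E] (g : SmoothMetric E M) (p : M) :
    CoordMetric.IsMetricAt (metricInChart g p) (coordPt E p) where
  contDiffAt := contDiffAt_metricInChart g p
  symm := .of_forall fun _ _ _ => g.symm _ _ _
  isInvertible := by
    -- Positive definiteness gives injectivity; equality of dimensions with the dual does the rest.
    have hinj : Function.Injective
        (metricInChart g p (coordPt E p) : E →ₗ[ℝ] (E →L[ℝ] ℝ)) := by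
      rw [injective_iff_map_eq_zero]
      intro v hv
      by_contra h
      have h₁ := g.pos p v h
      have h₂ : metricInChart g p (coordPt E p) v v = 0 :=
        DFunLike.congr_fun (show metricInChart g p (coordPt E p) v = 0 from hv) v
      exact h₁.ne' ((metricInChart_coordPt g p v v).symm.trans h₂)
    have hrank : Module.finrank ℝ E = Module.finrank ℝ (E →L[ℝ] ℝ) := by
      rw [← (LinearMap.toContinuousLinearMap (𝕜 := ℝ) (E := E) (F' := ℝ)).finrank_eq]
      exact (Subspace.dual_finrank_eq (K := ℝ) (V := E)).symm
    refine ⟨(LinearMap.linearEquivOfInjective _ hinj hrank).toContinuousLinearEquiv, ?_⟩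
    ext
    rfl

theorem metricInChart_conformal (g : SmoothMetric E M) (φ : M → ℝ)
    (hφ : ContMDiff 𝓘(ℝ, E) 𝓘(ℝ, ℝ) ∞ φ) (hpos : ∀ p, 0 < φ p) (p : M) (y : E) :
    metricInChart (conformal g φ hφ hpos) p y =
      (1 / funInChart φ p y ^ 2) • metricInChart g p y := by
  ext u v
  rfl

/-! ### Bilinear forms to which the trace lemma applies -/

noncomputable section Bilinear

/-- The metric at `p` as a bilinear form. -/
def innerBilin (g : SmoothMetric E M) (p : M) :
    TangentSpace 𝓘(ℝ, E) p →ₗ[ℝ] TangentSpace 𝓘(ℝ, E) p →ₗ[ℝ] ℝ :=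
  LinearMap.mk₂ ℝ (fun x y => g.inner p x y) (by simp) (by simp) (by simp) (by simp)

/-- The Hessian at `p` as a bilinear form. -/
def hessBilin (g : SmoothMetric E M) (f : M → ℝ) (p : M) :
    TangentSpace 𝓘(ℝ, E) p →ₗ[ℝ] TangentSpace 𝓘(ℝ, E) p →ₗ[ℝ] ℝ :=
  LinearMap.mk₂ ℝ (hess g f p)
    (by intros; simp only [hess, CoordMetric.cov, ← CoordMetric.christoffelL_apply, map_add,
          add_apply]; ring)
    (by intros; simp only [hess, CoordMetric.cov, ← CoordMetric.christoffelL_apply, map_add,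
          map_smul, add_apply, smul_apply, smul_eq_mul]; ring)
    (by intros; simp only [hess, map_add])
    (by intros; simp only [hess, map_smul])

theorem hessBilin_apply (g : SmoothMetric E M) (f : M → ℝ) (p : M)
    (x y : TangentSpace 𝓘(ℝ, E) p) : hessBilin g f p x y = hess g f p x y := rfl

variable [FiniteDimensional ℝ E]

theorem curv_eq (g : SmoothMetric E M) (p : M) (x y z w : TangentSpace 𝓘(ℝ, E) p) :
    letI Γ := CoordMetric.christoffelL (metricInChart g p)
    letI DΓ := fderiv ℝ Γ (coordPt E p)
    curv g p x y z w = metricInChart g p (coordPt E p)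
      (DΓ (toCoord p x) (toCoord p y) (toCoord p z) +
        Γ (coordPt E p) (toCoord p x) (Γ (coordPt E p) (toCoord p y) (toCoord p z)) -
        (DΓ (toCoord p y) (toCoord p x) (toCoord p z) +
          Γ (coordPt E p) (toCoord p y) (Γ (coordPt E p) (toCoord p x) (toCoord p z))))
      (toCoord p w) := by
  have := FiniteDimensional.complete ℝ E
  rw [curv, (isMetricAt_metricInChart g p).curvature_eq_christoffelL]

/-- The curvature form as a bilinear form in the outer arguments. -/
def curvOuter (g : SmoothMetric E M) (p : M) (x y : TangentSpace 𝓘(ℝ, E) p) :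
    TangentSpace 𝓘(ℝ, E) p →ₗ[ℝ] TangentSpace 𝓘(ℝ, E) p →ₗ[ℝ] ℝ :=
  LinearMap.mk₂ ℝ (fun a b => curv g p a x y b)
    (by intros; simp only [curv_eq, map_add, map_sub, add_apply, sub_apply]; ring)
    (by intros; simp only [curv_eq, map_add, map_sub, map_smul, add_apply, sub_apply, smul_apply,
          smul_eq_mul]; ring)
    (by intros; simp only [curv_eq, map_add])
    (by intros; simp only [curv_eq, map_smul])

theorem curvOuter_apply (g : SmoothMetric E M) (p : M) (x y a b : TangentSpace 𝓘(ℝ, E) p) :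
    curvOuter g p x y a b = curv g p a x y b := rfl

/-- The curvature form as a bilinear form in the inner arguments. -/
def curvInner (g : SmoothMetric E M) (p : M) (a b : TangentSpace 𝓘(ℝ, E) p) :
    TangentSpace 𝓘(ℝ, E) p →ₗ[ℝ] TangentSpace 𝓘(ℝ, E) p →ₗ[ℝ] ℝ :=
  LinearMap.mk₂ ℝ (fun x y => curv g p a x y b)
    (by intros; simp only [curv_eq, map_add, map_sub, add_apply, sub_apply]; ring)
    (by intros; simp only [curv_eq, map_add, map_sub, map_smul, add_apply, sub_apply, smul_apply,
          smul_eq_mul]; ring)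
    (by intros; simp only [curv_eq, map_add, map_sub, add_apply, sub_apply]; ring)
    (by intros; simp only [curv_eq, map_add, map_sub, map_smul, add_apply, sub_apply, smul_apply,
          smul_eq_mul]; ring)

theorem curvInner_apply (g : SmoothMetric E M) (p : M) (a b x y : TangentSpace 𝓘(ℝ, E) p) :
    curvInner g p a b x y = curv g p a x y b := rfl

end Bilinear

/-! ### Conformal change of the partial curvatures -/

section Conformal

variable (g : SmoothMetric E M) {φ : M → ℝ}
  (hφ : ContMDiff 𝓘(ℝ, E) 𝓘(ℝ, ℝ) ∞ φ) (hpos : ∀ p, 0 < φ p) {q : M}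

theorem IsOrthonormalBasis.inner_of_conformal {D : Submodule ℝ (TangentSpace 𝓘(ℝ, E) q)} {k : ℕ}
    {e : Fin k → TangentSpace 𝓘(ℝ, E) q}
    (he : IsOrthonormalBasis (conformal g φ hφ hpos) D e) (i j : Fin k) :
    g.inner q (e i) (e j) = if i = j then φ q ^ 2 else 0 := by
  have h := he.1 i j
  have hne := (hpos q).ne'
  change 1 / φ q ^ 2 * g.inner q (e i) (e j) = _ at h
  rw [one_div, inv_mul_eq_iff_eq_mul₀ (pow_ne_zero 2 hne)] at h
  rw [h]
  split_ifs <;> simp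

theorem sum_conformal_basis {D : Submodule ℝ (TangentSpace 𝓘(ℝ, E) q)} {k : ℕ}
    {e et : Fin k → TangentSpace 𝓘(ℝ, E) q} (he : IsOrthonormalBasis g D e)
    (het : IsOrthonormalBasis (conformal g φ hφ hpos) D et)
    (B : TangentSpace 𝓘(ℝ, E) q →ₗ[ℝ] TangentSpace 𝓘(ℝ, E) q →ₗ[ℝ] ℝ) :
    ∑ i, B (et i) (et i) = φ q ^ 2 * ∑ i, B (e i) (e i) := by
  refine sum_bilin_eq_mul_sum_bilin (innerBilin g q) B (pow_ne_zero 2 (hpos q).ne') he.1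
    (het.inner_of_conformal g hφ hpos) fun i => ?_
  rw [he.2, ← het.2]
  exact Submodule.subset_span ⟨i, rfl⟩

variable [FiniteDimensional ℝ E]

/-- The curvature form of the conformal metric `g / φ ^ 2`. -/
theorem curv_conformal (x y z w : TangentSpace 𝓘(ℝ, E) q) :
    curv (conformal g φ hφ hpos) q x y z w = (curv g q x y z w +
      (φ q)⁻¹ * (g.inner q y z * hess g φ q x w + hess g φ q y z * g.inner q x w -
        g.inner q x z * hess g φ q y w - hess g φ q x z * g.inner q y w) -
      (φ q ^ 2)⁻¹ * gradNormSq g φ q *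
        (g.inner q y z * g.inner q x w - g.inner q x z * g.inner q y w)) / φ q ^ 2 := by
  have := FiniteDimensional.complete ℝ E
  have hne : funInChart (E := E) φ q (coordPt E q) ≠ 0 := by
    rw [funInChart_coordPt]
    exact (hpos q).ne'
  have key := (isMetricAt_metricInChart g q).curvature_conformal (contDiffAt_funInChart hφ q) hne
    (.of_forall (metricInChart_conformal g φ hφ hpos q))
    (toCoord q x) (toCoord q y) (toCoord q z) (toCoord q w)
  have hin (a b : TangentSpace 𝓘(ℝ, E) q) :
      metricInChart g q (coordPt E q) (toCoord q a) (toCoord q b) = g.inner q a b := by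
    rw [toCoord_apply, toCoord_apply, metricInChart_coordPt]
  rw [curv, metricInChart_conformal, smul_apply, smul_apply, smul_eq_mul, key]
  simp only [hin, funInChart_coordPt]
  simp only [curv, hess, gradNormSq]
  ring

/-- Only orthogonality of x, y to the traced subspace matters, so one statement serves both
distributions. -/
theorem partialRic_conformal {D : Submodule ℝ (TangentSpace 𝓘(ℝ, E) q)} {k : ℕ}
    {e et : Fin k → TangentSpace 𝓘(ℝ, E) q} (he : IsOrthonormalBasis g D e)
    (het : IsOrthonormalBasis (conformal g φ hφ hpos) D et)
    {x y : TangentSpace 𝓘(ℝ, E) q} (hx : ∀ z ∈ D, g.inner q x z = 0)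
    (hy : ∀ z ∈ D, g.inner q y z = 0) :
    partialRic (conformal g φ hφ hpos) et x y = partialRic g e x y +
      (k * φ q * hess g φ q x y + (φ q * partialLaplacian g φ e - k * gradNormSq g φ q) *
        g.inner q x y) / φ q ^ 2 := by
  have hne := (hpos q).ne'
  have hmem (i : Fin k) : et i ∈ D := het.2 ▸ Submodule.subset_span ⟨i, rfl⟩
  -- The first two terms are bilinear forms in `et i`, so tracing them yields a factor φ²; the last
  -- is independent of i and is counted k times.
  have h₁ (i : Fin k) : curv (conformal g φ hφ hpos) q (et i) x y (et i) =
      (curvOuter g q x y (et i) (et i)) / φ q ^ 2 +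
        g.inner q x y / φ q ^ 3 * hessBilin g φ q (et i) (et i) +
        (hess g φ q x y / φ q - gradNormSq g φ q * g.inner q x y / φ q ^ 2) := by
    have h₂ := het.inner_of_conformal g hφ hpos i i
    rw [if_pos rfl] at h₂
    rw [curv_conformal, h₂, g.symm q (et i) y, hx _ (hmem i), hy _ (hmem i)]
    simp only [curvOuter_apply, hessBilin_apply]
    field_simp
    ring
  simp only [partialRic, h₁, Finset.sum_add_distrib, ← Finset.sum_div, ← Finset.mul_sum,
    sum_conformal_basis g hφ hpos he het, partialLaplacian, Finset.sum_const, Finset.card_univ,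
    Fintype.card_fin, nsmul_eq_mul]
  simp only [curvOuter_apply, hessBilin_apply]
  field_simp
  ring

/-- The mixed scalar curvature is the trace over D₂ of the partial Ricci form built from D₁, so the
previous formula is traced once more. -/
theorem mixedScal_conformal {D₁ D₂ : Submodule ℝ (TangentSpace 𝓘(ℝ, E) q)} {k l : ℕ}
    {e et : Fin k → TangentSpace 𝓘(ℝ, E) q} (he : IsOrthonormalBasis g D₁ e)
    (het : IsOrthonormalBasis (conformal g φ hφ hpos) D₁ et)
    {ε εt : Fin l → TangentSpace 𝓘(ℝ, E) q} (hε : IsOrthonormalBasis g D₂ ε)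
    (hεt : IsOrthonormalBasis (conformal g φ hφ hpos) D₂ εt)
    (horth : ∀ x ∈ D₂, ∀ y ∈ D₁, g.inner q x y = 0) :
    mixedScal (conformal g φ hφ hpos) et εt = φ q ^ 2 * mixedScal g e ε +
      φ q * (k * partialLaplacian g φ ε + l * partialLaplacian g φ e) -
      k * l * gradNormSq g φ q := by
  have hne := (hpos q).ne'
  have hmem (α : Fin l) : εt α ∈ D₂ := hεt.2 ▸ Submodule.subset_span ⟨α, rfl⟩
  have h₁ (α : Fin l) : partialRic (conformal g φ hφ hpos) et (εt α) (εt α) =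
      (∑ i, curvInner g q (e i) (e i)) (εt α) (εt α) +
        k / φ q * hessBilin g φ q (εt α) (εt α) +
        (φ q * partialLaplacian g φ e - k * gradNormSq g φ q) := by
    have h₂ := hεt.inner_of_conformal g hφ hpos α α
    rw [if_pos rfl] at h₂
    rw [partialRic_conformal g hφ hpos he het (horth _ (hmem α)) (horth _ (hmem α)), h₂]
    simp only [partialRic, LinearMap.sum_apply, curvInner_apply, hessBilin_apply]
    field_simp
    ring
  have h₃ : mixedScal (conformal g φ hφ hpos) et εt =
      ∑ α, partialRic (conformal g φ hφ hpos) et (εt α) (εt α) := Finset.sum_comm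
  have h₄ : mixedScal g e ε = ∑ α, (∑ i, curvInner g q (e i) (e i)) (ε α) (ε α) := by
    simp only [mixedScal, LinearMap.sum_apply, curvInner_apply]
    exact Finset.sum_comm
  rw [h₃, h₄]
  simp only [h₁, Finset.sum_add_distrib, ← Finset.mul_sum, sum_conformal_basis g hφ hpos hε hεt,
    Finset.sum_const, Finset.card_univ, Fintype.card_fin, nsmul_eq_mul]
  simp only [hessBilin_apply, partialLaplacian]
  field_simp
  ring

end Conformal

end PartialRicci

end

theorem proposition2 {E : Type*} [NormedAddCommGroup E] [NormedSpace ℝ E] [FiniteDimensional ℝ E]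
    {M : Type*} [TopologicalSpace M] [ChartedSpace E M] [IsManifold 𝓘(ℝ, E) ∞ M]
    (g : PartialRicci.SmoothMetric E M)
    (p₁ p₂ : ℕ) (hp₁ : 0 < p₁) (hp₂ : 0 < p₂)
    (D₁ : PartialRicci.SmoothDistribution E M p₁) (D₂ : PartialRicci.SmoothDistribution E M p₂)
    (hcompl : ∀ q, IsCompl (D₁.space q) (D₂.space q))
    (horth : ∀ q, ∀ x ∈ D₁.space q, ∀ y ∈ D₂.space q, g.inner q x y = 0)
    (φ : M → ℝ) (hφ : ContMDiff 𝓘(ℝ, E) 𝓘(ℝ, ℝ) ∞ φ) (hpos : ∀ q, 0 < φ q)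
    (gt : PartialRicci.SmoothMetric E M) (hgt : gt = PartialRicci.conformal g φ hφ hpos)
    (q : M)
    -- bases `e` of `D₁` and `ε` of `D₂` at `q`, orthonormal for `g`
    (e : Fin p₁ → TangentSpace 𝓘(ℝ, E) q) (he : PartialRicci.IsOrthonormalBasis g (D₁.space q) e)
    (ε : Fin p₂ → TangentSpace 𝓘(ℝ, E) q) (hε : PartialRicci.IsOrthonormalBasis g (D₂.space q) ε)
    -- bases `et` of `D₁` and `εt` of `D₂` at `q`, orthonormal for the conformal metric
    (et : Fin p₁ → TangentSpace 𝓘(ℝ, E) q)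
    (het : PartialRicci.IsOrthonormalBasis gt (D₁.space q) et)
    (εt : Fin p₂ → TangentSpace 𝓘(ℝ, E) q)
    (hεt : PartialRicci.IsOrthonormalBasis gt (D₂.space q) εt) :
    (∀ x ∈ D₁.space q, ∀ y ∈ D₁.space q,
      PartialRicci.partialRic gt εt x y = PartialRicci.partialRic g ε x y +
        (p₂ * φ q * PartialRicci.hess g φ q x y +
          (φ q * PartialRicci.partialLaplacian g φ ε - p₂ * PartialRicci.gradNormSq g φ q) *
            g.inner q x y) / φ q ^ 2) ∧
    (∀ x ∈ D₂.space q, ∀ y ∈ D₂.space q,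
      PartialRicci.partialRic gt et x y = PartialRicci.partialRic g e x y +
        (p₁ * φ q * PartialRicci.hess g φ q x y +
          (φ q * PartialRicci.partialLaplacian g φ e - p₁ * PartialRicci.gradNormSq g φ q) *
            g.inner q x y) / φ q ^ 2) ∧
    PartialRicci.mixedScal gt et εt = φ q ^ 2 * PartialRicci.mixedScal g e ε +
      φ q * (p₁ * PartialRicci.partialLaplacian g φ ε + p₂ * PartialRicci.partialLaplacian g φ e) -
      p₁ * p₂ * PartialRicci.gradNormSq g φ q := by
  subst hgt
  refine ⟨fun x hx y hy => ?_, fun x hx y hy => ?_, ?_⟩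
  · exact PartialRicci.partialRic_conformal g hφ hpos hε hεt (horth q x hx) (horth q y hy)
  · exact PartialRicci.partialRic_conformal g hφ hpos he het
      (fun z hz => by rw [g.symm]; exact horth q z hz x hx)
      (fun z hz => by rw [g.symm]; exact horth q z hz y hy)
  · exact PartialRicci.mixedScal_conformal g hφ hpos he het hε hεt
      (fun x hx y hy => by rw [g.symm]; exact horth q y hy x hx)
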